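/- Let $(\mathcal S,d_{\mathcal S})$ be a compact metric space with its Borel $\sigma$-algebra, let $\mathcal P(\mathcal S)$ be the set of Borel probability measures on $\mathcal S$ with the topology of weak convergence, let $\Pi:\mathbb R^d\times\mathcal S\to\mathcal P(\mathcal S)$ be continuous, and for $x\in\mathbb R^d$ let $$D(x)=\Big\{\mu\in\mathcal P(\mathcal S):\ \mu(A)=\int_{\mathcal S}\Pi(x,s)(A)\,\mu(ds)\ \text{for every Borel } A\subseteq\mathcal S\Big\}$$ be the set of stationary distributions of the Markov chain with transition kernel $\Pi(x,\cdot)(\cdot)$. Let $H:\mathbb R^d\times\mathcal S\to\{\text{subsets of }\mathbb R^d\}$ be a set-valued map with non-empty, compact, convex values and closed graph (if $(x_n,s_n)\to(x,s)$, $z_n\in H(x_n,s_n)$ and $z_n\to z$, then $z\in H(x,s)$), such that for some $K>0$, $\sup_{z\in H(x,s)}\|z\|\le K(1+\|x\|)$ for all $(x,s)$. Let $\{H^{(l)}\}_{l\ge1}$ be a sequence of set-valued maps $\mathbb R^d\times\mathcal S\to\{\text{subsets of }\mathbb R^d\}$ approximating $H$ in the following sense: for every $l\ge1$, 1. $H^{(l)}$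 has convex and compact values and is continuous, that is, upper semicontinuous (for all $(x_0,s_0)$ and $\epsilon>0$ there is $\delta>0$ such that $\|x-x_0\|<\delta$ and $d_{\mathcal S}(s,s_0)<\delta$ imply $H^{(l)}(x,s)\subseteq H^{(l)}(x_0,s_0)+\epsilon U$, with $U$ the closed unit ball of $\mathbb R^d$) and lower semicontinuous (for all $(x_0,s_0)$, $z_0\in H^{(l)}(x_0,s_0)$ and $(x_n,s_n)\to(x_0,s_0)$ there are $z_n\in H^{(l)}(x_n,s_n)$ with $z_n\to z_0$); 2. $H(x,s)\subseteq H^{(l+1)}(x,s)\subseteq H^{(l)}(x,s)$ for all $(x,s)$; 3. there is $K^{(l)}>0$ with $\sup_{z\in H^{(l)}(x,s)}\|z\|\le K^{(l)}(1+\|x\|)$ for all $(x,s)$; and $H(x,s)=\bigcap_{l\ge1}H^{(l)}(x,s)$ for all $(x,s)$. For $F:\mathcal S\to\{\text{subsets of }\mathbb R^d\}$ and $\mu\in\mathcal P(\mathcal S)$, let $\int_{\mathcal S}F(s)\,\mu(ds)$ denote Aumann's integral, the set of all $\int_{\mathcal S} f\,d\mu$ with $f:\mathcal S\to\mathbb R^d$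 measurable, $\mu$-integrable and $f(s)\in F(s)$ for every $s$. Put $$\hat H(x)=\bigcup_{\mu\in D(x)}\int_{\mathcal S}H(x,s)\,\mu(ds),\qquad \hat H^{(l)}(x)=\bigcup_{\mu\in D(x)}\int_{\mathcal S}H^{(l)}(x,s)\,\mu(ds)\quad(l\ge1).$$ Then for every $x\in\mathbb R^d$: (i) for every $l\ge1$, $\hat H(x)\subseteq\hat H^{(l+1)}(x)\subseteq\hat H^{(l)}(x)$; (ii) $\displaystyle\bigcup_{\mu\in D(x)}\bigcap_{l\ge1}\int_{\mathcal S}H^{(l)}(x,s)\,\mu(ds)=\bigcap_{l\ge1}\hat H^{(l)}(x)$; (iii) $\displaystyle\hat H(x)=\bigcap_{l\ge1}\hat H^{(l)}(x)$. -/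

import Mathlib

open MeasureTheory Filter Topology
open scoped Pointwise

noncomputable section

namespace SetValued

/-- `ℝ^d` with its Euclidean norm. -/
abbrev E (d : ℕ) : Type := EuclideanSpace ℝ (Fin d)

section Maps

variable {d : ℕ} {S : Type*} [MetricSpace S]

/-- The standing assumption on the drift `H : ℝ^d × S → {subsets of ℝ^d}`: non-empty compact convex
values, linear growth uniformly in the noise variable, and closed graph. -/
structure IsDrift (H : E d × S → Set (E d)) : Prop where
  nonempty : ∀ p, (H p).Nonempty
  isCompact : ∀ p, IsCompact (H p)
  convex : ∀ p, Convex ℝ (H p)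
  growth : ∃ K : ℝ, 0 < K ∧ ∀ (x : E d) (s : S), ∀ z ∈ H (x, s), ‖z‖ ≤ K * (1 + ‖x‖)
  closed_graph : ∀ (p : ℕ → E d × S) (p₀ : E d × S) (z : ℕ → E d) (z₀ : E d),
    Tendsto p atTop (𝓝 p₀) → (∀ n, z n ∈ H (p n)) → Tendsto z atTop (𝓝 z₀) → z₀ ∈ H p₀

/-- Upper semicontinuity (in the `ε`-`δ` sense) of a set-valued map. -/
def USC (H : E d × S → Set (E d)) : Prop :=
  ∀ (x₀ : E d) (s₀ : S), ∀ ε > (0 : ℝ), ∃ δ > (0 : ℝ), ∀ (x : E d) (s : S),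
    ‖x - x₀‖ < δ → dist s s₀ < δ →
      H (x, s) ⊆ H (x₀, s₀) + ε • Metric.closedBall (0 : E d) 1

/-- Lower semicontinuity of a set-valued map. -/
def LSC (H : E d × S → Set (E d)) : Prop :=
  ∀ (p₀ : E d × S), ∀ z₀ ∈ H p₀, ∀ p : ℕ → E d × S, Tendsto p atTop (𝓝 p₀) →
    ∃ z : ℕ → E d, (∀ n, z n ∈ H (p n)) ∧ Tendsto z atTop (𝓝 z₀)

/-- Continuity of a set-valued map. -/
def IsContinuous (H : E d × S → Set (E d)) : Prop := USC H ∧ LSC H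

/-- `(Hl l)`, `l ≥ 1`, is a decreasing sequence of continuous, convex and compact valued maps of
linear growth that approximates `H` from above. The value `Hl 0` is irrelevant. -/
structure IsApproximation (H : E d × S → Set (E d)) (Hl : ℕ → E d × S → Set (E d)) : Prop where
  continuous : ∀ l, 1 ≤ l → IsContinuous (Hl l)
  convex : ∀ l, 1 ≤ l → ∀ p, Convex ℝ (Hl l p)
  isCompact : ∀ l, 1 ≤ l → ∀ p, IsCompact (Hl l p)
  subset : ∀ l, 1 ≤ l → ∀ p, H p ⊆ Hl (l + 1) p
  anti : ∀ l, 1 ≤ l → ∀ p, Hl (l + 1) p ⊆ Hl l p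
  growth : ∀ l, 1 ≤ l → ∃ K : ℝ, 0 < K ∧
    ∀ (x : E d) (s : S), ∀ z ∈ Hl l (x, s), ‖z‖ ≤ K * (1 + ‖x‖)
  iInter_eq : ∀ p, H p = ⋂ (l : ℕ) (_ : 1 ≤ l), Hl l p

end Maps

section Integral

variable {d : ℕ} {S : Type*} [MeasurableSpace S]

/-- The set of (everywhere defined) measurable selections of a set-valued map. -/
def selections (F : S → Set (E d)) : Set (S → E d) :=
  {f | Measurable f ∧ ∀ s, f s ∈ F s}

/-- Aumann's integral: the set of integrals of the integrable measurable selections. -/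
def aumannIntegral (F : S → Set (E d)) (μ : Measure S) : Set (E d) :=
  {z | ∃ f ∈ selections F, Integrable f μ ∧ ∫ s, f s ∂μ = z}

/-- The set `D(x)` of stationary distributions of the Markov chain on `S` with transition kernel
`s ↦ P (x, s)`. -/
def stationary (P : E d × S → ProbabilityMeasure S) (x : E d) : Set (ProbabilityMeasure S) :=
  {μ | ∀ A : Set S, MeasurableSet A →
    (μ : Measure S) A = ∫⁻ s, (P (x, s) : Measure S) A ∂(μ : Measure S)}

/-- The averaged map `x ↦ ⋃_{μ ∈ D(x)} ∫ H(x, s) μ(ds)`. -/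
def averaged (P : E d × S → ProbabilityMeasure S) (H : E d × S → Set (E d)) (x : E d) :
    Set (E d) :=
  ⋃ μ ∈ stationary P x, aumannIntegral (fun s => H (x, s)) (μ : Measure S)

end Integral

end SetValued

end

/-! The chain `averaged P H x` ⊆ union of intersections ⊆ intersection of averages is monotonicity,
so everything rests on returning to `averaged P H x`. Write z as the integral of a selection f_n
against a stationary μ_n, for each n, and push μ_n onto the graph of f_n. These Young measures live
on S times one closed ball, a compact space, so they have a weak limit ρ. Its first marginal is
stationary (`isClosed_stationary`), its barycentre is z, and it is carried by the graph of every
approximation, hence by that of H. Disintegrating ρ over S and averaging in each convex fibre gives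
the required selection of H (`integral_snd_mem_aumannIntegral`). -/

namespace SetValued

/-! ### Closed graphs -/

section Graph

variable {d : ℕ} {S : Type*} [MetricSpace S]

/-- An upper semicontinuous map with compact values has closed sections of its graph. -/
theorem USC.isClosed_graph {H : E d × S → Set (E d)} (hH : USC H)
    (hc : ∀ p, IsCompact (H p)) (x : E d) :
    IsClosed {p : S × E d | p.2 ∈ H (x, p.1)} := by
  rw [← isOpen_compl_iff, Metric.isOpen_iff]
  rintro ⟨s₀, y₀⟩ hy₀
  obtain ⟨r, hr, hball⟩ := Metric.isOpen_iff.1 (hc (x, s₀)).isClosed.isOpen_compl y₀ hy₀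
  obtain ⟨δ, hδ, hsub⟩ := hH x s₀ (r / 2) (by positivity)
  refine ⟨min δ (r / 2), by positivity, ?_⟩
  rintro ⟨s, y⟩ hsy hy
  rw [Metric.mem_ball, Prod.dist_eq, max_lt_iff] at hsy
  obtain ⟨a, ha, b, hb, hab⟩ :=
    hsub x s (by simpa using hδ) (hsy.1.trans_le (min_le_left _ _)) hy
  obtain ⟨u, hu, rfl⟩ := hb
  refine hball (?_ : a ∈ _) ha
  have h1 : dist a y ≤ r / 2 := by
    change a + (r / 2) • u = y at hab
    rw [← hab, dist_eq_norm, sub_add_cancel_left, norm_neg, norm_smul, Real.norm_of_nonneg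
      (by positivity)]
    rw [mem_closedBall_zero_iff] at hu
    nlinarith
  have h2 : dist y y₀ < r / 2 := hsy.2.trans_le (min_le_right _ _)
  rw [Metric.mem_ball]
  linarith [dist_triangle a y y₀]

/-- Sections of the graph of a drift are closed. -/
theorem IsDrift.isClosed_graph {H : E d × S → Set (E d)} (hH : IsDrift H) (x : E d) :
    IsClosed {p : S × E d | p.2 ∈ H (x, p.1)} := by
  refine IsSeqClosed.isClosed fun p p₀ hp hlim => ?_
  refine hH.closed_graph (fun n => (x, (p n).1)) (x, p₀.1) (fun n => (p n).2) p₀.2 ?_ hp ?_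
  · exact tendsto_const_nhds.prodMk_nhds ((continuous_fst.tendsto _).comp hlim)
  · exact (continuous_snd.tendsto _).comp hlim

end Graph

/-! ### Measurable selections and barycentres -/

section Selection

variable {d : ℕ} {S : Type*} [MetricSpace S] [CompactSpace S] [MeasurableSpace S] [BorelSpace S]

/-- The distance from the origin to the part of the values of a map lying in a closed set is a
measurable function, if the graph is closed. -/
theorem measurable_infEDist_inter {F : S → Set (E d)} (hF : IsClosed {p : S × E d | p.2 ∈ F p.1})
    {C : Set (E d)} (hC : IsClosed C) :
    Measurable fun s => Metric.infEDist 0 (F s ∩ C) := by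
  refine measurable_of_Iic fun a => ?_
  -- Treated apart because `toReal` sends `⊤` to `0`. For finite a, the sublevel set is the
  -- projection of a compact part of the graph.
  rcases eq_or_ne a ⊤ with rfl | ha
  · simp
  suffices h : (fun s => Metric.infEDist 0 (F s ∩ C)) ⁻¹' Set.Iic a = Prod.fst ''
      ({p : S × E d | p.2 ∈ F p.1} ∩ Set.univ ×ˢ (C ∩ Metric.closedBall 0 a.toReal)) by
    rw [h]
    refine IsClosed.measurableSet (IsCompact.isClosed ?_)
    refine IsCompact.image ?_ continuous_fst
    exact (isCompact_univ.prod ((isCompact_closedBall _ _).inter_left hC)).inter_left hF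
  ext s
  have hcl : IsClosed (F s ∩ C) := by
    refine IsClosed.inter ?_ hC
    exact hF.preimage (Continuous.prodMk_right s)
  have key : ∀ y : E d, edist 0 y ≤ a ↔ y ∈ Metric.closedBall (0 : E d) a.toReal := by
    intro y
    rw [edist_dist, ENNReal.ofReal_le_iff_le_toReal ha, Metric.mem_closedBall']
  simp only [Set.mem_preimage, Set.mem_Iic, Set.mem_image, Set.mem_inter_iff, Set.mem_prod,
    Set.mem_univ, true_and, Prod.exists, exists_and_right, exists_eq_right]
  constructor
  · intro h
    have hne : (F s ∩ C).Nonempty := by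
      by_contra hne
      rw [Set.not_nonempty_iff_eq_empty] at hne
      rw [hne, Metric.infEDist_empty] at h
      exact ha (top_le_iff.1 h)
    obtain ⟨y, hy, hxy⟩ := hcl.exists_infDist_eq_dist hne 0
    refine ⟨y, hy.1, hy.2, (key y).1 ?_⟩
    rw [edist_dist, ← hxy, Metric.infDist, ENNReal.ofReal_toReal (Metric.infEDist_ne_top hne)]
    exact h
  · rintro ⟨y, hyF, hyC, hy⟩
    have hinf : Metric.infEDist 0 (F s ∩ C) ≤ edist 0 y :=
      Metric.infEDist_le_edist_of_mem (Set.mem_inter hyF hyC)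
    exact hinf.trans ((key y).2 hy)

/-- A map with closed graph and non-empty convex values has a measurable selection, that of the
points of minimal norm. -/
theorem selections_nonempty {F : S → Set (E d)} (hF : IsClosed {p : S × E d | p.2 ∈ F p.1})
    (hne : ∀ s, (F s).Nonempty) (hconv : ∀ s, Convex ℝ (F s)) : (selections F).Nonempty := by
  have hcl : ∀ s, IsClosed (F s) := fun s => hF.preimage (Continuous.prodMk_right s)
  choose g hgF hg using fun s => (hcl s).exists_infDist_eq_dist (hne s) 0
  -- Uniqueness of the point of minimal norm: the midpoint of two such points is no shorter, so the
  -- parallelogram law makes them equal.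
  have hmin : ∀ s, ∀ y ∈ F s, ‖y‖ ≤ ‖g s‖ → y = g s := by
    intro s y hy hyg
    have hle : ∀ z ∈ F s, ‖g s‖ ≤ ‖z‖ := fun z hz => by
      simpa [hg s] using Metric.infDist_le_dist_of_mem (x := (0 : E d)) hz
    have hmid := hle ((1 / 2 : ℝ) • y + (1 / 2 : ℝ) • g s) (hconv s hy (hgF s) (by norm_num : (0 : ℝ) ≤ 1 / 2)
      (by norm_num : (0 : ℝ) ≤ 1 / 2) (by norm_num))
    rw [← smul_add, norm_smul, Real.norm_of_nonneg (by norm_num)] at hmid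
    have hpar := parallelogram_law_with_norm ℝ y (g s)
    have hz : ‖y - g s‖ = 0 := by
      have := norm_nonneg (y - g s)
      have := norm_nonneg (g s)
      have := norm_nonneg y
      have : 2 * ‖g s‖ ≤ ‖y + g s‖ := by linarith
      nlinarith
    exact sub_eq_zero.1 (norm_eq_zero.1 hz)
  refine ⟨g, measurable_of_isClosed fun C hC => ?_, hgF⟩
  -- By uniqueness, g s lies in C exactly when restricting to C does not increase the distance to
  -- the origin.
  have hset : g ⁻¹' C = {s | Metric.infEDist 0 (F s ∩ C) ≤ Metric.infEDist 0 (F s ∩ Set.univ)} := by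
    ext s
    have hgs : Metric.infEDist 0 (F s) = edist 0 (g s) := by
      rw [edist_dist, ← hg s, Metric.infDist, ENNReal.ofReal_toReal (Metric.infEDist_ne_top (hne s))]
    simp only [Set.mem_preimage, Set.mem_ofPred_eq, Set.inter_univ, hgs]
    constructor
    · exact fun h => Metric.infEDist_le_edist_of_mem ⟨hgF s, h⟩
    · intro h
      have hne' : (F s ∩ C).Nonempty := by
        by_contra hne'
        rw [Set.not_nonempty_iff_eq_empty] at hne'
        rw [hne', Metric.infEDist_empty] at h
        exact edist_ne_top _ _ (top_le_iff.1 h)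
      obtain ⟨y, hy, hxy⟩ := ((hcl s).inter hC).exists_infDist_eq_dist hne' 0
      rw [← hmin s y hy.1 ?_]
      · exact hy.2
      · rw [← dist_zero_left, ← dist_zero_left, ← hxy, Metric.infDist]
        exact ENNReal.toReal_le_of_le_ofReal dist_nonneg (by rwa [← edist_dist])
  rw [hset]
  exact measurableSet_le (measurable_infEDist_inter hF hC)
    (measurable_infEDist_inter hF isClosed_univ)

open ProbabilityTheory in
/-- The barycentre of a probability measure carried by a graph with closed convex sections is an
Aumann integral with respect to the first marginal. -/
theorem integral_snd_mem_aumannIntegral {F : S → Set (E d)}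
    (hF : IsClosed {p : S × E d | p.2 ∈ F p.1}) (hne : ∀ s, (F s).Nonempty)
    (hconv : ∀ s, Convex ℝ (F s)) {ν : Measure (S × E d)} [IsProbabilityMeasure ν]
    (hν : ∀ᵐ p ∂ν, p.2 ∈ F p.1) (hint : Integrable Prod.snd ν) :
    ∫ p, p.2 ∂ν ∈ aumannIntegral F ν.fst := by
  obtain ⟨g, hgm, hgF⟩ := selections_nonempty hF hne hconv
  set f : S → E d := fun s => ∫ y, y ∂(ν.condKernel s)
  have hfm : Measurable f :=
    (measurable_snd.stronglyMeasurable.integral_kernel_prod_right' (κ := ν.condKernel)).measurable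
  have hfF : ∀ᵐ s ∂ν.fst, f s ∈ F s := by
    rw [← ν.disintegrate ν.condKernel] at hν hint
    filter_upwards [Measure.ae_ae_of_ae_compProd hν, hint.ae_of_compProd] with s hs hs'
    exact (hconv s).integral_mem (hF.preimage (Continuous.prodMk_right s)) hs hs'
  have hmeas : MeasurableSet {s | f s ∈ F s} :=
    hF.measurableSet.preimage (measurable_id.prodMk hfm)
  classical
  -- The conditional barycentre f lies in F only almost everywhere; g repairs it on the exceptional
  -- null set.
  have hae : Set.piecewise {s | f s ∈ F s} f g =ᵐ[ν.fst] f := by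
    filter_upwards [hfF] with s hs
    exact Set.piecewise_eq_of_mem _ _ _ hs
  refine ⟨Set.piecewise {s | f s ∈ F s} f g, ⟨hfm.piecewise hmeas hgm, fun s => ?_⟩, ?_, ?_⟩
  · by_cases hs : s ∈ {s | f s ∈ F s}
    · rw [Set.piecewise_eq_of_mem _ _ _ hs]
      exact hs
    · rw [Set.piecewise_eq_of_notMem _ _ _ hs]
      exact hgF s
  · exact (integrable_congr hae).2 hint.integral_condKernel
  · rw [integral_congr_ae hae]
    exact Measure.integral_condKernel hint

end Selection

/-! ### Stationary distributions of a Feller chain -/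

section Stationary

variable {d : ℕ} {S : Type*} [MetricSpace S] [MeasurableSpace S] [BorelSpace S]

/-- A weakly continuous family of probability measures is measurable. -/
theorem measurable_toMeasure_of_continuous {Q : S → ProbabilityMeasure S} (hQ : Continuous Q) :
    Measurable fun s => (Q s : Measure S) := by
  refine Measurable.measure_of_isPiSystem_of_isProbabilityMeasure
    (BorelSpace.measurable_eq (α := S)) isPiSystem_isOpen fun U hU => ?_
  refine LowerSemicontinuous.measurable (lowerSemicontinuous_iff_le_liminf.2 fun s => ?_)
  exact ProbabilityMeasure.le_liminf_measure_open_of_tendsto (hQ.tendsto s) hU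

/-- Stationarity can be tested on continuous functions. -/
theorem mem_stationary_iff {P : E d × S → ProbabilityMeasure S} (hP : Continuous P) (x : E d)
    (μ : ProbabilityMeasure S) :
    μ ∈ stationary P x ↔ ∀ g : BoundedContinuousFunction S NNReal,
      ∫⁻ s, g s ∂(μ : Measure S) = ∫⁻ s, ∫⁻ t, g t ∂(P (x, s) : Measure S) ∂(μ : Measure S) := by
  have hm : Measurable fun s => (P (x, s) : Measure S) :=
    measurable_toMeasure_of_continuous (hP.comp (Continuous.prodMk_right x))
  have hbind : ∀ g : BoundedContinuousFunction S NNReal,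
      ∫⁻ s, g s ∂((μ : Measure S).bind fun s => (P (x, s) : Measure S)) =
        ∫⁻ s, ∫⁻ t, g t ∂(P (x, s) : Measure S) ∂(μ : Measure S) := fun g =>
    Measure.lintegral_bind hm.aemeasurable g.continuous.measurable.coe_nnreal_ennreal.aemeasurable
  simp only [← hbind]
  constructor
  · intro h g
    congr 1
    ext A hA
    rw [Measure.bind_apply hA hm.aemeasurable]
    exact h A hA
  · intro h A hA
    rw [← Measure.bind_apply hA hm.aemeasurable]
    congr 1
    exact ext_of_forall_lintegral_eq_of_IsFiniteMeasure h

variable [CompactSpace S]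

/-- The set of stationary distributions of a Feller chain is closed. -/
theorem isClosed_stationary {P : E d × S → ProbabilityMeasure S} (hP : Continuous P) (x : E d) :
    IsClosed (stationary P x) := by
  have heq : stationary P x = ⋂ g : BoundedContinuousFunction S NNReal,
      {μ : ProbabilityMeasure S | ∫⁻ s, g s ∂(μ : Measure S) =
        ∫⁻ s, ∫⁻ t, g t ∂(P (x, s) : Measure S) ∂(μ : Measure S)} := by
    ext μ
    simpa using mem_stationary_iff hP x μ
  have hcont : ∀ g : BoundedContinuousFunction S NNReal,
      Continuous fun μ : ProbabilityMeasure S => ∫⁻ s, g s ∂(μ : Measure S) := fun g =>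
    continuous_iff_continuousAt.2 fun μ =>
      (ProbabilityMeasure.tendsto_iff_forall_lintegral_tendsto.1 tendsto_id) g
  rw [heq]
  refine isClosed_iInter fun g => isClosed_eq (hcont g) ?_
  have hfin : ∀ s, ∫⁻ t, g t ∂(P (x, s) : Measure S) ≠ ⊤ := fun s =>
    (g.lintegral_lt_top_of_nnreal _).ne
  -- Feller property: the kernel maps g to a continuous function, bounded by compactness, hence
  -- again a test function.
  have hc : Continuous fun s => (∫⁻ t, g t ∂(P (x, s) : Measure S)).toNNReal :=
    ENNReal.continuousOn_toNNReal.comp_continuous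
      ((hcont g).comp (hP.comp (Continuous.prodMk_right x))) hfin
  have h := hcont (BoundedContinuousFunction.mkOfCompact ⟨_, hc⟩)
  simpa [ENNReal.coe_toNNReal (hfin _)] using h

end Stationary

/-! ### Passage to the limit -/

section Approximation

variable {d : ℕ} {S : Type*} [MeasurableSpace S]

/-- Aumann's integral is monotone in the integrand. -/
theorem aumannIntegral_mono {F G : S → Set (E d)} (h : ∀ s, F s ⊆ G s) (μ : Measure S) :
    aumannIntegral F μ ⊆ aumannIntegral G μ := by
  rintro z ⟨f, ⟨hfm, hf⟩, hz⟩
  exact ⟨f, ⟨hfm, fun s => h s (hf s)⟩, hz⟩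

/-- The averaged map is monotone. -/
theorem averaged_mono (P : E d × S → ProbabilityMeasure S) {F G : E d × S → Set (E d)}
    (h : ∀ p, F p ⊆ G p) (x : E d) : averaged P F x ⊆ averaged P G x :=
  Set.iUnion₂_mono fun μ _ => aumannIntegral_mono (fun s => h (x, s)) (μ : Measure S)

variable [MetricSpace S] [CompactSpace S] [BorelSpace S]

/-- A point belonging to all averages of an approximation belongs to the average of the limit. -/
theorem IsApproximation.iInter_averaged_subset {P : E d × S → ProbabilityMeasure S}
    (hP : Continuous P) {H : E d × S → Set (E d)} (hH : IsDrift H)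
    {Hl : ℕ → E d × S → Set (E d)} (hHl : IsApproximation H Hl) (x : E d) :
    ⋂ (l : ℕ) (_ : 1 ≤ l), averaged P (Hl l) x ⊆ averaged P H x := by
  intro z hz
  have hz' : ∀ n : ℕ, ∃ μ ∈ stationary P x, ∃ f ∈ selections (fun s => Hl (n + 1) (x, s)),
      Integrable f (μ : Measure S) ∧ ∫ s, f s ∂(μ : Measure S) = z := by
    intro n
    simpa [averaged, aumannIntegral] using Set.mem_iInter₂.1 hz (n + 1) (by omega)
  choose μ hμ f hf hfint hfz using hz'
  have hanti : ∀ m n : ℕ, m ≤ n → ∀ p, Hl (n + 1) p ⊆ Hl (m + 1) p := fun m n hmn p =>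
    antitone_nat_of_succ_le (f := fun n => Hl (n + 1) p) (fun n => hHl.anti (n + 1) (by omega) p)
      hmn
  -- The maps decrease, so the growth constant of the first bounds all the selections.
  obtain ⟨K, -, hK⟩ := hHl.growth 1 le_rfl
  let R : ℝ := K * (1 + ‖x‖)
  let Y := S × Metric.closedBall (0 : E d) R
  have hfR : ∀ n s, f n s ∈ Metric.closedBall (0 : E d) R := fun n s =>
    mem_closedBall_zero_iff.2 (hK x s _ (hanti 0 n (Nat.zero_le n) _ ((hf n).2 s)))
  let φ : ℕ → S → Y := fun n s => (s, ⟨f n s, hfR n s⟩)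
  have hφ : ∀ n, Measurable (φ n) := fun n => measurable_id.prodMk ((hf n).1.subtype_mk)
  let ν : ℕ → ProbabilityMeasure Y := fun n => (μ n).map (hφ n).aemeasurable
  -- A limit along a nonprincipal ultrafilter replaces the extraction of a subsequence.
  obtain ⟨ρ, hρ⟩ : ∃ ρ, Tendsto ν (hyperfilter ℕ : Filter ℕ) (𝓝 ρ) := by
    obtain ⟨ρ, -, hρ⟩ := isCompact_univ.ultrafilter_le_nhds ((hyperfilter ℕ).map ν) (by simp)
    exact ⟨ρ, hρ⟩
  have hfst : ρ.map (continuous_fst (X := S)).measurable.aemeasurable ∈ stationary P x := by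
    refine (isClosed_stationary hP x).mem_of_tendsto
      (((ProbabilityMeasure.continuous_map continuous_fst).tendsto ρ).comp hρ)
      (Eventually.of_forall fun n => ?_)
    convert hμ n
    apply Subtype.ext
    change Measure.map Prod.fst (Measure.map (φ n) (μ n : Measure S)) = _
    rw [Measure.map_map measurable_fst (hφ n)]
    exact Measure.map_id
  have hsupp : ∀ᵐ p ∂(ρ : Measure Y), (p.2 : E d) ∈ H (x, p.1) := by
    -- For n ≥ m, ν n gives this closed graph full mass; the portmanteau theorem passes that to ρ.
    have hsupp_l : ∀ m : ℕ, ∀ᵐ p ∂(ρ : Measure Y), (p.2 : E d) ∈ Hl (m + 1) (x, p.1) := by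
      intro m
      have hclosed : IsClosed {p : Y | (p.2 : E d) ∈ Hl (m + 1) (x, p.1)} :=
        ((hHl.continuous (m + 1) (by omega)).1.isClosed_graph (hHl.isCompact (m + 1) (by omega))
          x).preimage (continuous_fst.prodMk (continuous_subtype_val.comp continuous_snd))
      refine (mem_ae_iff_prob_eq_one hclosed.measurableSet).2 ?_
      refine le_antisymm prob_le_one ?_
      refine le_trans (le_of_eq ?_)
        (ProbabilityMeasure.limsup_measure_closed_le_of_tendsto hρ hclosed)
      refine (Tendsto.limsup_eq (tendsto_const_nhds.congr' ?_)).symm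
      refine Nat.hyperfilter_le_atTop ((eventually_ge_atTop m).mono fun n hn => ?_)
      change 1 = Measure.map (φ n) (μ n : Measure S) _
      rw [Measure.map_apply (hφ n) hclosed.measurableSet]
      have : φ n ⁻¹' {p : Y | (p.2 : E d) ∈ Hl (m + 1) (x, p.1)} = Set.univ :=
        Set.eq_univ_of_forall fun s => hanti m n hn _ ((hf n).2 s)
      rw [this, measure_univ]
    filter_upwards [ae_all_iff.2 hsupp_l] with p hp
    rw [hHl.iInter_eq]
    refine Set.mem_iInter₂.2 fun l hl => ?_
    obtain ⟨m, rfl⟩ := Nat.exists_eq_add_of_le' hl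
    exact hp m
  have hcontsnd : Continuous fun p : Y => (p.2 : E d) := continuous_subtype_val.comp continuous_snd
  have hintρ : Integrable (fun p : Y => (p.2 : E d)) (ρ : Measure Y) :=
    Integrable.of_bound hcontsnd.aestronglyMeasurable R
      (Eventually.of_forall fun p => mem_closedBall_zero_iff.1 p.2.2)
  -- Coordinates are bounded continuous functions on Y, so weak convergence preserves the
  -- barycentre.
  have hbar : ∫ p, (p.2 : E d) ∂(ρ : Measure Y) = z := by
    ext i
    have hcoord : Continuous fun p : Y => (p.2 : E d) i :=
      (EuclideanSpace.proj (𝕜 := ℝ) i).continuous.comp hcontsnd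
    have hlim := ProbabilityMeasure.tendsto_iff_forall_integral_tendsto.1 hρ
      (BoundedContinuousFunction.mkOfCompact ⟨_, hcoord⟩)
    have hconst : ∀ n, ∫ p, (p.2 : E d) i ∂(ν n : Measure Y) = z i := by
      intro n
      change ∫ p, (p.2 : E d) i ∂(Measure.map (φ n) (μ n : Measure S)) = z i
      rw [integral_map (hφ n).aemeasurable hcoord.aestronglyMeasurable, ← hfz n]
      exact (EuclideanSpace.proj (𝕜 := ℝ) i).integral_comp_comm (hfint n)
    refine ((EuclideanSpace.proj (𝕜 := ℝ) i).integral_comp_comm hintρ).symm.trans ?_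
    refine tendsto_nhds_unique hlim ?_
    simp only [BoundedContinuousFunction.mkOfCompact_apply, ContinuousMap.coe_mk, hconst]
    exact tendsto_const_nhds
  have hψ : Measurable fun p : Y => (p.1, (p.2 : E d)) :=
    measurable_fst.prodMk hcontsnd.measurable
  have hgraph := hH.isClosed_graph x
  have := Measure.isProbabilityMeasure_map (μ := (ρ : Measure Y)) hψ.aemeasurable
  have hmem := integral_snd_mem_aumannIntegral (F := fun s => H (x, s))
    (ν := Measure.map (fun p : Y => (p.1, (p.2 : E d))) (ρ : Measure Y)) hgraph
    (fun s => hH.nonempty _) (fun s => hH.convex _)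
    ((ae_map_iff hψ.aemeasurable hgraph.measurableSet).2 hsupp)
    ((integrable_map_measure measurable_snd.aestronglyMeasurable hψ.aemeasurable).2 hintρ)
  rw [integral_map hψ.aemeasurable measurable_snd.aestronglyMeasurable, hbar, Measure.fst,
    Measure.map_map measurable_fst hψ] at hmem
  exact Set.mem_iUnion₂.2 ⟨_, hfst, hmem⟩

end Approximation

end SetValued

theorem mainTheorem7 (d : ℕ) {S : Type*} [MetricSpace S] [CompactSpace S] [MeasurableSpace S]
    [BorelSpace S]
    (P : SetValued.E d × S → ProbabilityMeasure S) (hP : Continuous P)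
    (H : SetValued.E d × S → Set (SetValued.E d)) (hH : SetValued.IsDrift H)
    (Hl : ℕ → SetValued.E d × S → Set (SetValued.E d)) (hHl : SetValued.IsApproximation H Hl)
    (x : SetValued.E d) :
    (∀ l : ℕ, 1 ≤ l →
      SetValued.averaged P H x ⊆ SetValued.averaged P (Hl (l + 1)) x ∧
      SetValued.averaged P (Hl (l + 1)) x ⊆ SetValued.averaged P (Hl l) x) ∧
    (⋃ μ ∈ SetValued.stationary P x, ⋂ (l : ℕ) (_ : 1 ≤ l),
        SetValued.aumannIntegral (fun s => Hl l (x, s)) (μ : Measure S)) =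
      (⋂ (l : ℕ) (_ : 1 ≤ l), SetValued.averaged P (Hl l) x) ∧
    SetValued.averaged P H x = ⋂ (l : ℕ) (_ : 1 ≤ l), SetValued.averaged P (Hl l) x := by
  have hsub : ∀ l, 1 ≤ l → ∀ p, H p ⊆ Hl l p := fun l hl p =>
    (hHl.subset l hl p).trans (hHl.anti l hl p)
  have h_inter := hHl.iInter_averaged_subset hP hH x
  have h_left : SetValued.averaged P H x ⊆ ⋃ μ ∈ SetValued.stationary P x,
      ⋂ (l : ℕ) (_ : 1 ≤ l),
        SetValued.aumannIntegral (fun s => Hl l (x, s)) (μ : Measure S) :=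
    Set.iUnion₂_mono fun μ _ => Set.subset_iInter₂ fun l hl =>
      SetValued.aumannIntegral_mono (fun s => hsub l hl (x, s)) _
  have h_right : (⋃ μ ∈ SetValued.stationary P x, ⋂ (l : ℕ) (_ : 1 ≤ l),
        SetValued.aumannIntegral (fun s => Hl l (x, s)) (μ : Measure S)) ⊆
      ⋂ (l : ℕ) (_ : 1 ≤ l), SetValued.averaged P (Hl l) x :=
    Set.subset_iInter₂ fun l hl => Set.iUnion₂_mono fun μ _ => Set.iInter₂_subset l hl
  exact ⟨fun l hl => ⟨SetValued.averaged_mono P (hHl.subset l hl) x,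
      SetValued.averaged_mono P (hHl.anti l hl) x⟩,
    h_right.antisymm (h_inter.trans h_left), (h_left.trans h_right).antisymm h_inter⟩
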